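/- Let $H$ be a complex Hilbert space. For a contraction $A$ on $H$ (a bounded linear operator with $\|A\|\le 1$) and $z\in\mathbb{C}$, $|z|<1$, put $K_z(A)=(I-\overline{z}A)^{-1}+(I-zA^{*})^{-1}-I$. A contraction $A$ is called Harnack dominated by a contraction $B$ if there is a constant $c\ge 1$ such that $K_z(A)\le c^{2}K_z(B)$ for all $z$ with $|z|<1$ (where $X\le Y$ means that $Y-X$ is a positive operator), and $A$ and $B$ are called Harnack equivalent if each of them is Harnack dominated by the other. Let $T$ be a compact linear operator on $H$ with $\|T\|=1$ which has no eigenvalue of modulus $1$, and let $S$ be a compact contraction on $H$. Then $S$ is Harnack equivalent to $T$ if and only if $\ker(I-S^{*}S)=\ker(I-T^{*}T)$ and $Sx=Tx$ for every $x\in\ker(I-T^{*}T)$. -/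

import Mathlib

/-- The operatorial `ρ`-kernel `K_z^ρ(T) = (I - z̄ T)⁻¹ + (I - z T*)⁻¹ + (ρ - 2) I` of a bounded
operator `T` on a complex Hilbert space. It is used for `|z| < 1` and `T` with spectrum in the closed
unit disc; the two operators inverted here are then invertible, so `Ring.inverse` is the genuine
inverse in `B(H)`. -/
noncomputable def rhoKernel {H : Type*} [NormedAddCommGroup H] [InnerProductSpace ℂ H]
    [CompleteSpace H] (ρ : ℝ) (T : H →L[ℂ] H) (z : ℂ) : H →L[ℂ] H :=
  Ring.inverse (1 - (starRingEnd ℂ z) • T)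
    + Ring.inverse (1 - z • ContinuousLinearMap.adjoint T)
    + ((ρ - 2 : ℝ) : ℂ) • (1 : H →L[ℂ] H)

/-- `T₁` is Harnack dominated by `T₀` (for `T₀`, `T₁` in the class `C_ρ(H)`; for `ρ = 1` these are the
contractions): there is a constant `c ≥ 1` with `K_z^ρ(T₁) ≤ c² K_z^ρ(T₀)` for all `z` in the open
unit disc. The order is the Loewner order: `A ≤ B` means that `B - A` is a positive operator. -/
def HarnackDominated {H : Type*} [NormedAddCommGroup H] [InnerProductSpace ℂ H]
    [CompleteSpace H] (ρ : ℝ) (T₁ T₀ : H →L[ℂ] H) : Prop :=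
  ∃ c : ℝ, 1 ≤ c ∧ ∀ z : ℂ, ‖z‖ < 1 →
    rhoKernel ρ T₁ z ≤ ((c ^ 2 : ℝ) : ℂ) • rhoKernel ρ T₀ z

/-- Harnack equivalence: the equivalence relation induced by the preorder of Harnack domination. -/
def HarnackEquivalent {H : Type*} [NormedAddCommGroup H] [InnerProductSpace ℂ H]
    [CompleteSpace H] (ρ : ℝ) (T₁ T₀ : H →L[ℂ] H) : Prop :=
  HarnackDominated ρ T₁ T₀ ∧ HarnackDominated ρ T₀ T₁

/-! With `w = conj z` and `y = (1 - wA)⁻¹x`, the quadratic form of the kernel is `‖y‖² - |w|²‖Ay‖²`.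
A compact contraction without unimodular eigenvalues has a resolvent `(1 - wA)⁻¹` holomorphic near
the closed disc, hence bounded on it.

Necessity: domination by `T` excludes unimodular eigenvalues of `S` and extends to `|w| = 1`. There,
testing on `(1 - wT)x` with `‖Tx‖ = ‖x‖` puts `(1 - wS)⁻¹(1 - wT)x` in `E = ker(1 - S*S)`. The
maximum principle gives `x ∈ E`; then `u = (S - T)x` satisfies `Sⁿu ∈ E` for all `n`, so `‖Sⁿu‖ =
‖u‖`, while `Sⁿ → 0` (`mem_ker_and_apply_eq_of_defectForm_le`).

Sufficiency: on the common kernel `S = T`, and off it compactness makes `‖y‖² - ‖Ty‖²` comparable to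
the squared distance from `y` to the kernel. This controls the perturbation from `T` to `S`
uniformly in `w` (`exists_defectForm_le`). -/

open ContinuousLinearMap Complex Metric Filter Topology
open scoped InnerProductSpace

/-! ### The kernel as a quadratic form. -/

section

variable {H : Type*} [NormedAddCommGroup H] [InnerProductSpace ℂ H]

/-- The quadratic form of `K_z(A)`, in the variable `w = conj z`. -/
noncomputable def defectForm (A : H →L[ℂ] H) (w : ℂ) (x : H) : ℝ :=
  ‖Ring.inverse (1 - w • A) x‖ ^ 2 - ‖w‖ ^ 2 * ‖A (Ring.inverse (1 - w • A) x)‖ ^ 2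

theorem inverse_apply_apply {B : H →L[ℂ] H} (hB : IsUnit B) (x : H) :
    Ring.inverse B (B x) = x := by
  exact congr($(Ring.inverse_mul_cancel _ hB) x)

theorem apply_inverse_apply {B : H →L[ℂ] H} (hB : IsUnit B) (x : H) :
    B (Ring.inverse B x) = x := by
  exact congr($(Ring.mul_inverse_cancel _ hB) x)

variable [CompleteSpace H]

theorem rhoKernel_one_eq (A : H →L[ℂ] H) (z : ℂ) :
    rhoKernel 1 A z = Ring.inverse (1 - (starRingEnd ℂ z) • A)
      + adjoint (Ring.inverse (1 - (starRingEnd ℂ z) • A)) - 1 := by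
  have h : (1 - z • adjoint A) = star (1 - (starRingEnd ℂ z) • A) := by
    simp [star_sub, star_smul, star_eq_adjoint]
  rw [rhoKernel, h, Ring.inverse_star, star_eq_adjoint]
  norm_num [sub_eq_add_neg]

theorem isSelfAdjoint_rhoKernel_one (A : H →L[ℂ] H) (z : ℂ) :
    IsSelfAdjoint (rhoKernel 1 A z) := by
  rw [rhoKernel_one_eq, isSelfAdjoint_iff, ← star_eq_adjoint, star_sub, star_add, star_star,
    star_one, add_comm]

theorem re_inner_rhoKernel_one (A : H →L[ℂ] H) (z : ℂ)
    (hu : IsUnit (1 - (starRingEnd ℂ z) • A)) (x : H) :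
    (⟪rhoKernel 1 A z x, x⟫_ℂ).re = defectForm A (starRingEnd ℂ z) x := by
  rw [rhoKernel_one_eq, defectForm]
  set R := Ring.inverse (1 - (starRingEnd ℂ z) • A) with hR
  set v := (starRingEnd ℂ z) • A (R x) with hv
  -- The formula comes from expanding `‖R x - x‖²`, since `R x - x = w A R x`.
  have hx : R x - x = v := by
    have := apply_inverse_apply hu x
    rw [← hR] at this
    nth_rewrite 2 [← this]
    simp [hv]
  have h1 : ‖v‖ ^ 2 = ‖z‖ ^ 2 * ‖A (R x)‖ ^ 2 := by
    rw [hv, norm_smul, mul_pow]; simp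
  have h2 := @norm_sub_sq ℂ _ _ _ _ (R x) x
  rw [hx, h1] at h2
  have h3 : (⟪x, R x⟫_ℂ).re = (⟪R x, x⟫_ℂ).re := inner_re_symm (𝕜 := ℂ) _ _
  have h4 : (⟪x, x⟫_ℂ).re = ‖x‖ ^ 2 := (norm_sq_eq_re_inner (𝕜 := ℂ) x).symm
  change (⟪R x + adjoint R x - x, x⟫_ℂ).re = _
  simp only [inner_sub_left, inner_add_left, adjoint_inner_left, sub_re, add_re, h3, h4,
    RCLike.norm_conj]
  simp only [RCLike.re_to_complex] at h2
  linarith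

theorem isUnit_one_sub_smul_of_norm_lt {A : H →L[ℂ] H} (hA : ‖A‖ ≤ 1) {w : ℂ} (hw : ‖w‖ < 1) :
    IsUnit (1 - w • A) := by
  apply isUnit_one_sub_of_norm_lt_one
  rw [norm_smul]
  nlinarith [norm_nonneg w, norm_nonneg A]

theorem harnackDominated_one_iff {S T : H →L[ℂ] H} (hS : ‖S‖ ≤ 1) (hT : ‖T‖ ≤ 1) :
    HarnackDominated 1 S T ↔ ∃ c : ℝ, 1 ≤ c ∧ ∀ w : ℂ, ‖w‖ < 1 → ∀ x : H,
      defectForm S w x ≤ c ^ 2 * defectForm T w x := by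
  have key : ∀ (c : ℝ) (z : ℂ), ‖z‖ < 1 →
      (rhoKernel 1 S z ≤ ((c ^ 2 : ℝ) : ℂ) • rhoKernel 1 T z ↔
        ∀ x : H, defectForm S (starRingEnd ℂ z) x ≤ c ^ 2 * defectForm T (starRingEnd ℂ z) x) := by
    intro c z hz
    have hz' : ‖starRingEnd ℂ z‖ < 1 := by simpa using hz
    have hsa : IsSelfAdjoint (((c ^ 2 : ℝ) : ℂ) • rhoKernel 1 T z - rhoKernel 1 S z) := by
      refine IsSelfAdjoint.sub ?_ (isSelfAdjoint_rhoKernel_one S z)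
      refine IsSelfAdjoint.smul ?_ (isSelfAdjoint_rhoKernel_one T z)
      exact Complex.conj_ofReal _
    rw [ContinuousLinearMap.le_def, isPositive_def', and_iff_right hsa]
    refine forall_congr' fun x => ?_
    rw [← re_inner_rhoKernel_one S z (isUnit_one_sub_smul_of_norm_lt hS hz'),
      ← re_inner_rhoKernel_one T z (isUnit_one_sub_smul_of_norm_lt hT hz')]
    simp only [reApplyInnerSelf, sub_apply, smul_apply, inner_sub_left, inner_smul_left,
      Complex.conj_ofReal, map_sub, RCLike.re_to_complex, re_ofReal_mul]
    exact sub_nonneg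
  constructor
  · rintro ⟨c, hc, h⟩
    refine ⟨c, hc, fun w hw x => ?_⟩
    have := (key c (starRingEnd ℂ w) (by simpa using hw)).1 (h _ (by simpa using hw)) x
    simpa using this
  · rintro ⟨c, hc, h⟩
    exact ⟨c, hc, fun z hz => (key c z hz).2 (h _ (by simpa using hz))⟩

/-- Expand the square and use `‖A*Ax‖ ≤ ‖Ax‖`. It shows that the kernel of `1 - A*A` is exactly
where `A` preserves the norm. -/
theorem norm_one_sub_adjoint_mul_apply_sq_le {A : H →L[ℂ] H} (hA : ‖A‖ ≤ 1) (x : H) :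
    ‖(1 - adjoint A * A) x‖ ^ 2 ≤ ‖x‖ ^ 2 - ‖A x‖ ^ 2 := by
  have h1 : (⟪x, adjoint A (A x)⟫_ℂ).re = ‖A x‖ ^ 2 := by
    rw [adjoint_inner_right]; exact (norm_sq_eq_re_inner (𝕜 := ℂ) _).symm
  have h2 : ‖adjoint A (A x)‖ ≤ ‖A x‖ :=
    (adjoint A).le_of_opNorm_le (by rwa [LinearIsometryEquiv.norm_map]) _ |>.trans_eq (one_mul _)
  have h3 := pow_le_pow_left₀ (norm_nonneg _) h2 2
  have h4 := @norm_sub_sq ℂ _ _ _ _ x (adjoint A (A x))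
  simp only [RCLike.re_to_complex, h1] at h4
  change ‖x - adjoint A (A x)‖ ^ 2 ≤ _
  linarith

theorem mem_ker_one_sub_adjoint_mul_iff {A : H →L[ℂ] H} (hA : ‖A‖ ≤ 1) (x : H) :
    x ∈ (1 - adjoint A * A).ker ↔ ‖A x‖ = ‖x‖ := by
  have hle := norm_one_sub_adjoint_mul_apply_sq_le hA x
  rw [LinearMap.mem_ker]
  constructor
  · intro h
    have h1 : adjoint A (A x) = x := (sub_eq_zero.1 h).symm
    refine (sq_eq_sq₀ (norm_nonneg _) (norm_nonneg _)).1 ?_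
    rw [@norm_sq_eq_re_inner ℂ, ← adjoint_inner_left, h1, ← norm_sq_eq_re_inner]
  · intro h
    rw [h, sub_self] at hle
    exact norm_eq_zero.1 (pow_eq_zero_iff two_ne_zero |>.1 (le_antisymm hle (sq_nonneg _)))

end

/-! ### Resolvents on the closed disc, the spectral gap, and sufficiency. -/

section

variable {H : Type*} [NormedAddCommGroup H] [InnerProductSpace ℂ H] [CompleteSpace H]

/-- On the circle `1 - wA = w(w⁻¹ - A)`, and the Fredholm alternative applies. -/
theorem isUnit_one_sub_smul_of_isCompactOperator {A : H →L[ℂ] H} (hA : ‖A‖ ≤ 1)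
    (hc : IsCompactOperator A)
    (he : ∀ μ : ℂ, ‖μ‖ = 1 → ¬ Module.End.HasEigenvalue (A : H →ₗ[ℂ] H) μ)
    {w : ℂ} (hw : ‖w‖ ≤ 1) : IsUnit (1 - w • A) := by
  rcases hw.lt_or_eq with h | h
  · exact isUnit_one_sub_smul_of_norm_lt hA h
  · have hw0 : w ≠ 0 := by rintro rfl; simp at h
    have hr := (hc.hasEigenvalue_or_mem_resolventSet (inv_ne_zero hw0)).resolve_left
      (he w⁻¹ (by simp [h]))
    rw [spectrum.mem_resolventSet_iff] at hr
    have : (1 - w • A) = (Units.mk0 w hw0) • (algebraMap ℂ (H →L[ℂ] H) w⁻¹ - A) := by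
      ext x
      simp [Units.smul_def, smul_sub, Algebra.algebraMap_eq_smul_one, smul_smul, hw0]
    rw [this]
    exact hr.smul _

variable {A : H →L[ℂ] H}

theorem differentiableAt_inverse_one_sub_smul {w : ℂ} (hu : IsUnit (1 - w • A)) :
    DifferentiableAt ℂ (fun w : ℂ => Ring.inverse (1 - w • A)) w := by
  have h : DifferentiableAt ℂ (fun w : ℂ => 1 - w • A) w := by fun_prop
  exact (differentiableAt_inverse hu).comp w h

theorem exists_norm_inverse_one_sub_smul_le (hu : ∀ w : ℂ, ‖w‖ ≤ 1 → IsUnit (1 - w • A)) :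
    ∃ M : ℝ, 0 ≤ M ∧ ∀ w : ℂ, ‖w‖ ≤ 1 → ‖Ring.inverse (1 - w • A)‖ ≤ M := by
  have hcont : ContinuousOn (fun w : ℂ => Ring.inverse (1 - w • A)) (closedBall 0 1) :=
    fun w hw => (differentiableAt_inverse_one_sub_smul
      (hu w (by simpa using hw))).continuousAt.continuousWithinAt
  obtain ⟨M, hM⟩ := (isCompact_closedBall (0 : ℂ) 1).exists_bound_of_continuousOn hcont
  exact ⟨M, (norm_nonneg _).trans (hM 0 (by simp)), fun w hw => hM w (by simpa using hw)⟩

theorem continuousOn_defectForm (hu : ∀ w : ℂ, ‖w‖ ≤ 1 → IsUnit (1 - w • A)) (x : H) :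
    ContinuousOn (fun w => defectForm A w x) (closedBall 0 1) := by
  have h : ContinuousOn (fun w : ℂ => Ring.inverse (1 - w • A) x) (closedBall 0 1) :=
    fun w hw => ((differentiableAt_inverse_one_sub_smul
      (hu w (by simpa using hw))).continuousAt.clm_apply continuousAt_const).continuousWithinAt
  unfold defectForm
  fun_prop

/-- The spectrum lies in the open disc, so Gelfand's formula gives geometric decay. -/
theorem tendsto_pow_zero_of_isUnit_one_sub_smul [Nontrivial H]
    (hu : ∀ w : ℂ, ‖w‖ ≤ 1 → IsUnit (1 - w • A)) :
    Tendsto (fun n : ℕ => ‖A ^ n‖) atTop (𝓝 0) := by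
  have hr : spectralRadius ℂ A < 1 := by
    refine spectrum.spectralRadius_lt_of_forall_lt A (r := 1) fun k hk => ?_
    by_contra! hk1
    have hk1' : 1 ≤ ‖k‖ := by exact_mod_cast hk1
    have hk0 : k ≠ 0 := by rintro rfl; norm_num at hk1'
    refine spectrum.notMem_iff.2 ?_ hk
    have h := hu k⁻¹ (by rw [norm_inv]; exact inv_le_one_of_one_le₀ hk1')
    have : algebraMap ℂ (H →L[ℂ] H) k - A = (Units.mk0 k hk0) • (1 - k⁻¹ • A) := by
      ext x
      simp [Units.smul_def, smul_sub, Algebra.algebraMap_eq_smul_one, smul_smul, hk0]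
    rw [this]
    exact h.smul _
  obtain ⟨q, hq1, hq2⟩ := ENNReal.lt_iff_exists_nnreal_btwn.1 hr
  have hq2 : q < 1 := by exact_mod_cast hq2
  have hev := (spectrum.pow_nnnorm_pow_one_div_tendsto_nhds_spectralRadius A).eventually_lt_const
    hq1
  refine squeeze_zero' (Eventually.of_forall fun n => norm_nonneg _) ?_
    (tendsto_pow_atTop_nhds_zero_of_lt_one q.2 (by exact_mod_cast hq2 : (q : ℝ) < 1))
  filter_upwards [hev, eventually_gt_atTop 0] with n hn hn0
  have h1 : (‖A ^ n‖₊ : ENNReal) ≤ (q : ENNReal) ^ n := by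
    have := pow_le_pow_left₀ zero_le hn.le n
    rwa [← ENNReal.rpow_natCast, ← ENNReal.rpow_mul, one_div_mul_cancel (by positivity),
      ENNReal.rpow_one] at this
  exact_mod_cast h1

/-- With `P` the projection onto `E`, the compact operator `G = A*A(1 - P)` does not have eigenvalue
`1`, so `1 - G` is bounded below; and `(1 - G)(y - Py) = (1 - A*A)y`. -/
theorem exists_pos_le_sq_sub_sq (hA : ‖A‖ ≤ 1) (hc : IsCompactOperator A)
    (E : Submodule ℂ H) [E.HasOrthogonalProjection] (hE : E = (1 - adjoint A * A).ker) :
    ∃ κ : ℝ, 0 < κ ∧ ∀ y : H, κ * ‖y - E.starProjection y‖ ^ 2 ≤ ‖y‖ ^ 2 - ‖A y‖ ^ 2 := by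
  set G : H →L[ℂ] H := adjoint A * A * (1 - E.starProjection) with hG
  have hGc : IsCompactOperator G := by
    have h1 : IsCompactOperator (adjoint A ∘L A) := hc.clm_comp (adjoint A)
    exact h1.comp_clm (1 - E.starProjection)
  have hGe : ¬ Module.End.HasEigenvalue (G : H →ₗ[ℂ] H) 1 := by
    intro h
    obtain ⟨x, hx⟩ := h.exists_hasEigenvector
    have hGx : adjoint A (A (x - E.starProjection x)) = x := by
      simpa [hG] using hx.apply_eq_smul
    set u := x - E.starProjection x with hu
    -- A fixed vector of `G` is no longer than its part orthogonal to `E`, so it is orthogonal to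
    -- `E`; it is then fixed by `A*A`, hence also in `E`.
    have hle : ‖x‖ ≤ ‖u‖ := by
      rw [← hGx]
      calc ‖adjoint A (A u)‖ ≤ 1 * ‖A u‖ :=
            (adjoint A).le_of_opNorm_le (by rwa [LinearIsometryEquiv.norm_map]) _
        _ ≤ ‖u‖ := by rw [one_mul]; simpa using A.le_of_opNorm_le hA u
    have hpx : E.starProjection x = 0 := by
      have hpy := E.norm_sq_eq_add_norm_sq_starProjection x
      rw [E.starProjection_orthogonal_val, ← hu] at hpy
      have := pow_le_pow_left₀ (norm_nonneg _) hle 2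
      exact norm_eq_zero.1 (pow_eq_zero_iff two_ne_zero |>.1
        (le_antisymm (by linarith) (sq_nonneg _)))
    have hux : u = x := by rw [hu, hpx, sub_zero]
    have hxE : x ∈ E := by
      rw [hE, LinearMap.mem_ker]
      rw [hux] at hGx
      exact sub_eq_zero.2 hGx.symm
    rw [E.starProjection_eq_self_iff.2 hxE] at hpx
    exact hx.2 hpx
  obtain ⟨K, hK⟩ := hGc.antilipschitz_of_not_hasEigenvalue one_ne_zero hGe
  have hK' : ∃ k : ℝ, 0 < k ∧ ∀ x, ‖x‖ ≤ k * ‖G x - x‖ := by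
    refine ⟨K + 1, by positivity, fun x => ?_⟩
    have := hK.le_mul_dist x 0
    simp only [dist_zero_right, map_zero] at this
    refine this.trans ?_
    change K * ‖G x - (1 : ℂ) • x‖ ≤ _
    rw [one_smul]
    gcongr
    linarith
  obtain ⟨k, hk, hkx⟩ := hK'
  refine ⟨(k ^ 2)⁻¹, by positivity, fun y => ?_⟩
  set u := y - E.starProjection y with hu
  have hPu : E.starProjection u = 0 :=
    E.starProjection_apply_eq_zero_iff.2 (E.sub_starProjection_mem_orthogonal y)
  have h1 : (1 - adjoint A * A) y = u - G u := by
    have h2 : (1 - adjoint A * A) (E.starProjection y) = 0 := by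
      have : E.starProjection y ∈ (1 - adjoint A * A).ker := hE ▸ E.starProjection_apply_mem y
      exact this
    have h3 : G u = (adjoint A * A) u := by simp [hG, hPu]
    rw [h3]
    have : (1 - adjoint A * A) y = (1 - adjoint A * A) u := by
      rw [hu, map_sub, h2, sub_zero]
    rw [this]; rfl
  have h4 := norm_one_sub_adjoint_mul_apply_sq_le hA y
  have h5 := hkx u
  rw [h1, norm_sub_rev] at h4
  have h6 := pow_le_pow_left₀ (norm_nonneg _) h5 2
  rw [mul_pow] at h6
  rw [inv_mul_le_iff₀ (by positivity)]
  exact h6.trans (by gcongr)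

/-- `A` is isometric on `E` and, since `A*A` fixes `E`, maps `E` and its complement to orthogonal
sets. -/
theorem sq_sub_sq_le_of_ker (hA : ‖A‖ ≤ 1)
    (E : Submodule ℂ H) [E.HasOrthogonalProjection] (hE : E = (1 - adjoint A * A).ker) (y : H) :
    ‖y‖ ^ 2 - ‖A y‖ ^ 2 ≤ ‖y - E.starProjection y‖ ^ 2 := by
  set p := E.starProjection y with hp
  set q := y - p with hq
  have hpE : p ∈ E := E.starProjection_apply_mem y
  have hyq : y = p + q := by simp [hq]
  have hpq : ⟪p, q⟫_ℂ = 0 := E.sub_starProjection_mem_orthogonal y p hpE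
  rw [hE] at hpE
  have hAp : ‖A p‖ = ‖p‖ := (mem_ker_one_sub_adjoint_mul_iff hA p).1 hpE
  have hAA : adjoint A (A p) = p := (sub_eq_zero.1 (LinearMap.mem_ker.1 hpE)).symm
  have hApq : ⟪A p, A q⟫_ℂ = 0 := by rw [← adjoint_inner_left, hAA, hpq]
  have h1 := @norm_add_sq ℂ _ _ _ _ p q
  have h2 := @norm_add_sq ℂ _ _ _ _ (A p) (A q)
  rw [hpq, map_zero] at h1
  rw [hApq, map_zero, hAp, ← map_add] at h2
  rw [hyq, h1, h2]
  nlinarith [sq_nonneg ‖A q‖]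

/-- The scalar core of `exists_defectForm_le`: `r = |w|²`, `t = ‖Ty‖`, `s = ‖Sv‖`, and `q`, `b` are
the distances of `y`, `v` to the kernel. The form `y² - rt²` dominates both `(1 - r)y²` and `κq²`,
and these control `v² - rs²`. -/
theorem sq_sub_mul_sq_le_of_gap {M κ r y v t s q b : ℝ} (hM : 0 ≤ M) (hκ : 0 < κ) (hr0 : 0 ≤ r)
    (hr1 : r ≤ 1) (hv : 0 ≤ v) (ht : 0 ≤ t) (hs : 0 ≤ s) (hb : 0 ≤ b)
    (hty : t ≤ y) (hsv : s ≤ v) (hvy : v ≤ y + M * q) (hbq : b ≤ (1 + M) * q)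
    (hup : v ^ 2 - s ^ 2 ≤ b ^ 2) (hlow : κ * q ^ 2 ≤ y ^ 2 - t ^ 2) :
    v ^ 2 - r * s ^ 2 ≤ (2 + (2 * M ^ 2 + (1 + M) ^ 2) / κ) * (y ^ 2 - r * t ^ 2) := by
  have hr1' : 0 ≤ 1 - r := by linarith
  have sty : t ^ 2 ≤ y ^ 2 := pow_le_pow_left₀ ht hty 2
  have ssv : s ^ 2 ≤ v ^ 2 := pow_le_pow_left₀ hs hsv 2
  have svy : v ^ 2 ≤ 2 * y ^ 2 + 2 * (M ^ 2 * q ^ 2) := by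
    have := pow_le_pow_left₀ hv hvy 2
    linarith [sq_nonneg (y - M * q), add_sq y (M * q), sub_sq y (M * q), mul_pow M q 2]
  have sbq : b ^ 2 ≤ (1 + M) ^ 2 * q ^ 2 := by
    rw [← mul_pow]; exact pow_le_pow_left₀ hb hbq 2
  set N := y ^ 2 - r * t ^ 2 with hN
  have hN1 : (1 - r) * y ^ 2 ≤ N := by
    linarith [mul_le_mul_of_nonneg_left sty hr0]
  have hN2 : κ * q ^ 2 ≤ N := by
    linarith [mul_nonneg hr1' (sq_nonneg t)]
  have hN3 : q ^ 2 ≤ N / κ := by rwa [le_div_iff₀ hκ, mul_comm]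
  calc v ^ 2 - r * s ^ 2
      ≤ (1 - r) * v ^ 2 + b ^ 2 := by
        linarith [mul_le_mul_of_nonneg_left ssv hr1']
    _ ≤ (1 - r) * (2 * y ^ 2 + 2 * (M ^ 2 * q ^ 2)) + (1 + M) ^ 2 * q ^ 2 := by gcongr
    _ ≤ 2 * N + (2 * M ^ 2 + (1 + M) ^ 2) * q ^ 2 := by
        have : 0 ≤ r * (M ^ 2 * q ^ 2) := by positivity
        linarith
    _ ≤ 2 * N + (2 * M ^ 2 + (1 + M) ^ 2) * (N / κ) := by gcongr
    _ = (2 + (2 * M ^ 2 + (1 + M) ^ 2) / κ) * N := by ring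

theorem exists_defectForm_le {S T : H →L[ℂ] H} (hS : ‖S‖ ≤ 1) (hT : ‖T‖ ≤ 1)
    (hTc : IsCompactOperator T) (hSu : ∀ w : ℂ, ‖w‖ ≤ 1 → IsUnit (1 - w • S))
    (hTu : ∀ w : ℂ, ‖w‖ ≤ 1 → IsUnit (1 - w • T))
    (hker : (1 - adjoint S * S).ker = (1 - adjoint T * T).ker)
    (hST : ∀ x ∈ (1 - adjoint T * T).ker, S x = T x) :
    ∃ c : ℝ, 1 ≤ c ∧ ∀ w : ℂ, ‖w‖ < 1 → ∀ x : H,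
      defectForm S w x ≤ c ^ 2 * defectForm T w x := by
  obtain ⟨E, hE⟩ : ∃ E : Submodule ℂ H, E = (1 - adjoint T * T).ker := ⟨_, rfl⟩
  have hEc : IsClosed (E : Set H) := by
    rw [hE]; exact (1 - adjoint T * T).isClosed_ker
  have : CompleteSpace E := hEc.completeSpace_coe
  obtain ⟨κ, hκ, hgap⟩ := exists_pos_le_sq_sub_sq hT hTc E hE
  obtain ⟨M₀, hM₀, hM₀'⟩ := exists_norm_inverse_one_sub_smul_le hSu
  set M := M₀ * ‖S - T‖ with hM
  have hMn : 0 ≤ M := by positivity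
  set C := 2 + (2 * M ^ 2 + (1 + M) ^ 2) / κ with hC
  have hC1 : 1 ≤ C := by
    have : 0 ≤ (2 * M ^ 2 + (1 + M) ^ 2) / κ := by positivity
    linarith
  refine ⟨√C, Real.one_le_sqrt.2 hC1, fun w hw x => ?_⟩
  rw [Real.sq_sqrt (by linarith)]
  unfold defectForm
  set y := Ring.inverse (1 - w • T) x with hy
  set v := Ring.inverse (1 - w • S) x with hv
  set q := y - E.starProjection y with hq
  set d := Ring.inverse (1 - w • S) (w • (S - T) q) with hd
  -- Second resolvent identity; `S - T` kills the component of `y` in `E`, so the correction `d` is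
  -- of size `‖q‖`.
  have hvy : v = y + d := by
    have h1 : (S - T) y = (S - T) q := by
      have : (S - T) (E.starProjection y) = 0 := by
        have hm : E.starProjection y ∈ (1 - adjoint T * T).ker :=
          hE ▸ E.starProjection_apply_mem y
        exact sub_eq_zero.2 (hST _ hm)
      rw [hq, map_sub, this, sub_zero]
    have h2 : x = (1 - w • S) y + w • (S - T) y := by
      conv_lhs => rw [← apply_inverse_apply (hTu w hw.le) x]
      change y - w • T y = (y - w • S y) + w • (S y - T y)
      module
    rw [hv, hd, ← h1]
    conv_lhs => rw [h2]
    rw [map_add, inverse_apply_apply (hSu w hw.le)]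
  have hdq : ‖d‖ ≤ M * ‖q‖ := by
    calc ‖d‖ ≤ M₀ * ‖w • (S - T) q‖ := le_of_opNorm_le _ (hM₀' w hw.le) _
      _ ≤ M₀ * (1 * (‖S - T‖ * ‖q‖)) := by
          rw [norm_smul]
          gcongr
          exact (S - T).le_opNorm q
      _ = M * ‖q‖ := by rw [hM]; ring
  have hTy : ‖T y‖ ≤ ‖y‖ := by simpa using T.le_of_opNorm_le hT y
  have hSv : ‖S v‖ ≤ ‖v‖ := by simpa using S.le_of_opNorm_le hS v
  have hvn : ‖v‖ ≤ ‖y‖ + M * ‖q‖ := by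
    rw [hvy]; exact (norm_add_le _ _).trans (by gcongr)
  have hqv : ‖v - E.starProjection v‖ ≤ (1 + M) * ‖q‖ := by
    have h1 : v - E.starProjection v = q + (d - E.starProjection d) := by
      rw [hvy, map_add, hq]; abel
    have h2 : ‖d - E.starProjection d‖ ≤ ‖d‖ := by
      rw [← E.starProjection_orthogonal_val]
      exact Eᗮ.norm_starProjection_apply_le d
    rw [h1]
    refine (norm_add_le _ _).trans ?_
    linarith
  have hup := sq_sub_sq_le_of_ker hS E (hE.trans hker.symm) v
  have hgy := hgap y
  have hr : ‖w‖ ^ 2 ≤ 1 := pow_le_one₀ (norm_nonneg _) hw.le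
  have hr0 : 0 ≤ ‖w‖ ^ 2 := by positivity
  exact sq_sub_mul_sq_le_of_gap hMn hκ hr0 hr (by positivity) (by positivity) (by positivity) (by positivity)
    hTy hSv hvn hqv hup hgy

end

/-! ### Boundary behaviour and necessity. -/

section

variable {H : Type*} [NormedAddCommGroup H] [InnerProductSpace ℂ H]

/-- On a unimodular eigenvector the form is `(1 + r)/(1 - r) ‖x‖²`, which blows up as `r → 1`. The
form of `T` stays bounded, so domination rules out such eigenvectors. -/
theorem defectForm_of_apply_eq_smul {S : H →L[ℂ] H} {μ : ℂ} {x : H} (hμ : ‖μ‖ = 1)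
    (hx : S x = μ • x) {r : ℝ} (hr0 : 0 ≤ r) (hr1 : r < 1)
    (hu : IsUnit (1 - ((r : ℂ) * starRingEnd ℂ μ) • S)) :
    (1 - r) * defectForm S ((r : ℂ) * starRingEnd ℂ μ) x = (1 + r) * ‖x‖ ^ 2 := by
  set w : ℂ := (r : ℂ) * starRingEnd ℂ μ with hw
  have hwμ : w * μ = r := by
    rw [hw, mul_assoc, mul_comm _ μ, Complex.mul_conj, Complex.normSq_eq_norm_sq, hμ]; simp
  have h1r : (1 - r : ℝ) ≠ 0 := by linarith
  have hR : Ring.inverse (1 - w • S) x = ((1 - r : ℝ) : ℂ)⁻¹ • x := by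
    have h1 : (1 - w • S) x = ((1 - r : ℝ) : ℂ) • x := by
      change x - w • S x = _
      rw [hx, smul_smul, hwμ]
      push_cast
      rw [sub_smul, one_smul]
    have h2 := inverse_apply_apply hu x
    rw [h1, map_smul] at h2
    rw [eq_inv_smul_iff₀ (by exact_mod_cast h1r), h2]
  have hwn : ‖w‖ = r := by simp [hw, hμ, abs_of_nonneg hr0]
  have h1 : ‖((1 - r : ℝ) : ℂ)⁻¹‖ = (1 - r)⁻¹ := by
    rw [norm_inv, Complex.norm_real, Real.norm_of_nonneg (by linarith)]
  rw [defectForm, hR, map_smul, hx, norm_smul, norm_smul, norm_smul, hμ, h1, hwn]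
  field_simp
  ring

/-- A function holomorphic on a neighbourhood of the closed unit disc that takes values in a closed
subspace on the unit circle does so at the centre. -/
theorem apply_zero_mem_of_forall_sphere_mem {f : ℂ → H} {E : Submodule ℂ H}
    [E.HasOrthogonalProjection] (hf : ∀ w : ℂ, ‖w‖ ≤ 1 → DifferentiableAt ℂ f w)
    (hE : ∀ w : ℂ, ‖w‖ = 1 → f w ∈ E) : f 0 ∈ E := by
  have hd : DifferentiableOn ℂ f (closure (ball 0 1)) := fun w hw => by
    rw [closure_ball _ one_ne_zero] at hw
    exact (hf w (by simpa using hw)).differentiableWithinAt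
  have hg : DiffContOnCl ℂ (fun w => E.starProjection (f w)) (ball 0 1) :=
    DifferentiableOn.diffContOnCl fun w hw =>
      (E.starProjection.differentiableAt.comp_differentiableWithinAt w (hd w hw))
  have h := Complex.eqOn_of_eqOn_frontier isBounded_ball hg hd.diffContOnCl (fun w hw => by
    rw [frontier_ball _ one_ne_zero] at hw
    exact E.starProjection_eq_self_iff.2 (hE w (by simpa using hw)))
  exact E.starProjection_eq_self_iff.1 (h (mem_ball_self one_pos))

variable [CompleteSpace H]

theorem not_hasEigenvalue_of_defectForm_le {S T : H →L[ℂ] H} (hS : ‖S‖ ≤ 1)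
    (hTu : ∀ w : ℂ, ‖w‖ ≤ 1 → IsUnit (1 - w • T)) {c : ℝ}
    (hc : ∀ w : ℂ, ‖w‖ < 1 → ∀ x : H, defectForm S w x ≤ c ^ 2 * defectForm T w x)
    (μ : ℂ) (hμ : ‖μ‖ = 1) : ¬ Module.End.HasEigenvalue (S : H →ₗ[ℂ] H) μ := by
  intro he
  obtain ⟨x, hx⟩ := he.exists_hasEigenvector
  have hxS : S x = μ • x := hx.apply_eq_smul
  obtain ⟨M, hM0, hM⟩ := exists_norm_inverse_one_sub_smul_le hTu
  have hx0 : 0 < ‖x‖ ^ 2 := by have := norm_pos_iff.2 hx.2; positivity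
  have hbound : ∀ r : ℝ, 0 ≤ r → r < 1 →
      (1 + r) * ‖x‖ ^ 2 ≤ (1 - r) * (c ^ 2 * (M * ‖x‖) ^ 2) := by
    intro r hr0 hr1
    have hwn : ‖(r : ℂ) * starRingEnd ℂ μ‖ < 1 := by simpa [hμ, abs_of_nonneg hr0] using hr1
    rw [← defectForm_of_apply_eq_smul hμ hxS hr0 hr1 (isUnit_one_sub_smul_of_norm_lt hS hwn)]
    have h1 : 0 ≤ 1 - r := by linarith
    gcongr
    refine (hc _ hwn x).trans ?_
    gcongr
    refine (sub_le_self _ (by positivity)).trans ?_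
    gcongr
    exact le_of_opNorm_le _ (hM _ hwn.le) x
  have hlim := le_of_tendsto_of_tendsto (b := 𝓝[<] (1 : ℝ))
    (f := fun r : ℝ => (1 + r) * ‖x‖ ^ 2) (g := fun r : ℝ => (1 - r) * (c ^ 2 * (M * ‖x‖) ^ 2))
    (a₁ := (1 + 1) * ‖x‖ ^ 2) (a₂ := (1 - 1) * (c ^ 2 * (M * ‖x‖) ^ 2))
    ((Continuous.tendsto (by fun_prop) _).mono_left nhdsWithin_le_nhds)
    ((Continuous.tendsto (by fun_prop) _).mono_left nhdsWithin_le_nhds) (by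
      filter_upwards [Ioo_mem_nhdsLT (show (0 : ℝ) < 1 by norm_num)] with r hr
      exact hbound r hr.1.le hr.2)
  linarith

theorem defectForm_le_of_norm_le_one {S T : H →L[ℂ] H}
    (hSu : ∀ w : ℂ, ‖w‖ ≤ 1 → IsUnit (1 - w • S)) (hTu : ∀ w : ℂ, ‖w‖ ≤ 1 → IsUnit (1 - w • T))
    {c : ℝ} (hc : ∀ w : ℂ, ‖w‖ < 1 → ∀ x : H, defectForm S w x ≤ c ^ 2 * defectForm T w x)
    {w : ℂ} (hw : ‖w‖ ≤ 1) (x : H) : defectForm S w x ≤ c ^ 2 * defectForm T w x := by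
  have hcl : closure (ball (0 : ℂ) 1) = closedBall 0 1 := closure_ball _ one_ne_zero
  refine le_on_closure (s := ball (0 : ℂ) 1) (fun w hw => hc w (by simpa using hw) x)
    (hcl ▸ continuousOn_defectForm hSu x)
    (hcl ▸ (continuousOn_defectForm hTu x).const_mul (c ^ 2)) ?_
  rw [hcl]; simpa using hw

theorem mem_ker_and_apply_eq_of_defectForm_le [Nontrivial H] {S T : H →L[ℂ] H} (hS : ‖S‖ ≤ 1)
    (hT : ‖T‖ ≤ 1)
    (hSu : ∀ w : ℂ, ‖w‖ ≤ 1 → IsUnit (1 - w • S)) (hTu : ∀ w : ℂ, ‖w‖ ≤ 1 → IsUnit (1 - w • T))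
    {c : ℝ} (hc : ∀ w : ℂ, ‖w‖ < 1 → ∀ x : H, defectForm S w x ≤ c ^ 2 * defectForm T w x)
    {x : H} (hx : x ∈ (1 - adjoint T * T).ker) :
    x ∈ (1 - adjoint S * S).ker ∧ S x = T x := by
  obtain ⟨E, hE⟩ : ∃ E : Submodule ℂ H, E = (1 - adjoint S * S).ker := ⟨_, rfl⟩
  have hEc : IsClosed (E : Set H) := by
    rw [hE]; exact (1 - adjoint S * S).isClosed_ker
  have : CompleteSpace E := hEc.completeSpace_coe
  have memE : ∀ y, y ∈ E ↔ ‖S y‖ = ‖y‖ := fun y => by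
    rw [hE]; exact mem_ker_one_sub_adjoint_mul_iff hS y
  have hdiff : ∀ w : ℂ, ‖w‖ ≤ 1 →
      DifferentiableAt ℂ (fun w : ℂ => Ring.inverse (1 - w • S)) w :=
    fun w hw => differentiableAt_inverse_one_sub_smul (hSu w hw)
  -- For this vector the form of `T` is `‖x‖² - ‖Tx‖² = 0`.
  have hbdry : ∀ w : ℂ, ‖w‖ = 1 → Ring.inverse (1 - w • S) ((1 - w • T) x) ∈ E := by
    intro w hw
    have h := defectForm_le_of_norm_le_one hSu hTu hc hw.le ((1 - w • T) x)
    rw [defectForm, defectForm, inverse_apply_apply (hTu w hw.le), hw,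
      (mem_ker_one_sub_adjoint_mul_iff hT x).1 hx] at h
    set v := Ring.inverse (1 - w • S) ((1 - w • T) x)
    have hSv : ‖S v‖ ≤ ‖v‖ := by simpa using S.le_of_opNorm_le hS v
    refine (memE v).2 (le_antisymm hSv ?_)
    exact (sq_le_sq₀ (norm_nonneg _) (norm_nonneg _)).1 (by linarith)
  have hxE : x ∈ E := by
    have := apply_zero_mem_of_forall_sphere_mem (E := E)
      (f := fun w : ℂ => Ring.inverse (1 - w • S) ((1 - w • T) x)) (fun w hw => ?_) hbdry
    · simpa using this
    · have h1 : DifferentiableAt ℂ (fun w : ℂ => (1 - w • T) x) w := by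
        change DifferentiableAt ℂ (fun w : ℂ => x - w • T x) w
        fun_prop
      exact (hdiff w hw).clm_apply h1
  set u := (S - T) x with hu
  have hres : ∀ (y : H) (w : ℂ), ‖w‖ ≤ 1 → Ring.inverse (1 - w • S) y
      = y + w • Ring.inverse (1 - w • S) (S y) := by
    intro y w hw
    have h : (1 - w • S) y + w • S y = y := by
      change y - w • S y + w • S y = y
      abel
    conv_lhs => rw [← h]
    rw [map_add, map_smul, inverse_apply_apply (hSu w hw)]
  have hmem : ∀ y : H, (∀ w : ℂ, ‖w‖ = 1 → Ring.inverse (1 - w • S) y ∈ E) → y ∈ E := by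
    intro y hy
    have := apply_zero_mem_of_forall_sphere_mem (E := E)
      (f := fun w : ℂ => Ring.inverse (1 - w • S) y)
      (fun w hw => (hdiff w hw).clm_apply (differentiableAt_const y)) hy
    simpa using this
  have hne : ∀ w : ℂ, ‖w‖ = 1 → w ≠ 0 := fun w hw => norm_ne_zero_iff.1 (by simp [hw])
  -- The induction carries the whole circle: `hmem` uses all `w` to get `Sⁿu ∈ E`, and subtracting
  -- this from the resolvent expansion `hres` leaves the claim for `Sⁿ⁺¹u`.
  have hpow : ∀ n : ℕ, ∀ w : ℂ, ‖w‖ = 1 → Ring.inverse (1 - w • S) ((S ^ n) u) ∈ E := by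
    intro n
    induction n with
    | zero =>
      intro w hw
      have h : (1 - w • T) x = (1 - w • S) x + w • u := by
        change x - w • T x = (x - w • S x) + w • (S x - T x)
        module
      have h1 := hbdry w hw
      rw [h, map_add, map_smul, inverse_apply_apply (hSu w hw.le)] at h1
      exact (E.smul_mem_iff (hne w hw)).1 ((E.add_mem_iff_right hxE).1 h1)
    | succ n ih =>
      intro w hw
      have h1 := ih w hw
      rw [hres _ w hw.le] at h1
      rw [pow_succ']
      exact (E.smul_mem_iff (hne w hw)).1 ((E.add_mem_iff_right (hmem _ ih)).1 h1)
  have hnorm : ∀ n : ℕ, ‖(S ^ n) u‖ = ‖u‖ := by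
    intro n
    induction n with
    | zero => rfl
    | succ n ih =>
      rw [pow_succ', ← ih]
      exact (memE _).1 (hmem _ (hpow n))
  have hlim : ‖u‖ ≤ 0 * ‖u‖ :=
    ge_of_tendsto' ((tendsto_pow_zero_of_isUnit_one_sub_smul hSu).mul_const ‖u‖)
      fun n => (hnorm n).symm.trans_le ((S ^ n).le_opNorm u)
  rw [zero_mul, norm_le_zero_iff] at hlim
  exact ⟨hE ▸ hxE, sub_eq_zero.1 hlim⟩

end

theorem corollary2p11 {H : Type*} [NormedAddCommGroup H] [InnerProductSpace ℂ H]
    [CompleteSpace H] (T S : H →L[ℂ] H)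
    (hTcompact : IsCompactOperator T) (hTnorm : ‖T‖ = 1)
    (hTeig : ∀ μ : ℂ, ‖μ‖ = 1 → ¬ Module.End.HasEigenvalue (T : H →ₗ[ℂ] H) μ)
    (hScompact : IsCompactOperator S) (hSnorm : ‖S‖ ≤ 1) :
    HarnackEquivalent 1 S T ↔
      (1 - ContinuousLinearMap.adjoint S * S).ker = (1 - ContinuousLinearMap.adjoint T * T).ker ∧
        ∀ x ∈ (1 - ContinuousLinearMap.adjoint T * T).ker, S x = T x := by
  have hT := hTnorm.le
  have : Nontrivial H := by
    by_contra h
    rw [not_nontrivial_iff_subsingleton] at h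
    rw [Subsingleton.elim T 0, norm_zero] at hTnorm
    exact zero_ne_one hTnorm
  have hTu : ∀ w : ℂ, ‖w‖ ≤ 1 → IsUnit (1 - w • T) := fun w =>
    isUnit_one_sub_smul_of_isCompactOperator hT hTcompact hTeig
  rw [HarnackEquivalent, harnackDominated_one_iff hSnorm hT, harnackDominated_one_iff hT hSnorm]
  constructor
  · rintro ⟨⟨c, -, hc⟩, ⟨d, -, hd⟩⟩
    have hSu : ∀ w : ℂ, ‖w‖ ≤ 1 → IsUnit (1 - w • S) := fun w =>
      isUnit_one_sub_smul_of_isCompactOperator hSnorm hScompact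
        (not_hasEigenvalue_of_defectForm_le hSnorm hTu hc)
    have h1 : ∀ x ∈ (1 - adjoint T * T).ker, x ∈ (1 - adjoint S * S).ker ∧ S x = T x :=
      fun x hx => mem_ker_and_apply_eq_of_defectForm_le hSnorm hT hSu hTu hc hx
    exact ⟨le_antisymm
      (fun x hx => (mem_ker_and_apply_eq_of_defectForm_le hT hSnorm hTu hSu hd hx).1)
      fun x hx => (h1 x hx).1, fun x hx => (h1 x hx).2⟩
  · rintro ⟨hker, hST⟩
    -- A unimodular eigenvector of `S` lies in the common kernel, where `S = T`, so it would be one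
    -- of `T`.
    have hSe : ∀ μ : ℂ, ‖μ‖ = 1 → ¬ Module.End.HasEigenvalue (S : H →ₗ[ℂ] H) μ := by
      intro μ hμ he
      obtain ⟨x, hx⟩ := he.exists_hasEigenvector
      have hSx : S x = μ • x := hx.apply_eq_smul
      have hxS : x ∈ (1 - adjoint S * S).ker := by
        rw [mem_ker_one_sub_adjoint_mul_iff hSnorm, hSx, norm_smul, hμ, one_mul]
      have hTx : T x = μ • x := by rw [← hST x (hker ▸ hxS), hSx]
      exact hTeig μ hμ (Module.End.hasEigenvalue_of_hasEigenvector
        (Module.End.hasEigenvector_iff.2 ⟨Module.End.mem_eigenspace_iff.2 hTx, hx.2⟩))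
    have hSu : ∀ w : ℂ, ‖w‖ ≤ 1 → IsUnit (1 - w • S) := fun w =>
      isUnit_one_sub_smul_of_isCompactOperator hSnorm hScompact hSe
    exact ⟨exists_defectForm_le hSnorm hT hTcompact hSu hTu hker hST,
      exists_defectForm_le hT hSnorm hScompact hTu hSu hker.symm
        fun x hx => (hST x (hker ▸ hx)).symm⟩
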